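/- Let $M$ be a closed (compact, Hausdorff, without boundary, not necessarily connected) $C^\infty$ $n$-manifold, $n\ge 2$, and let $N=S_1\sqcup\dots\sqcup S_m\subset M$ be a disjoint union of $m$ smoothly embedded circles. For each $i$ fix a diffeomorphism $\mathbb R/\mathbb Z\cong S_i$, with induced universal covering $\pi_i:\mathbb R\to S_i$, and a point $p_i\in S_i$. A $C^\infty$ isotopy of $M$ is a $C^\infty$ diffeomorphism $F$ of $M\times[0,1]$ of the form $F(x,t)=(F_t(x),t)$. Let $\mathrm{Isot}(M,N)_0$ be the group (under composition) of those isotopies with $F_0=\mathrm{id}_M$ and $F_t(N)=N$ for all $t$, let $\mathrm{Isot}(M,N)_{\mathrm{id},\mathrm{id}}$ be its subgroup of those with also $F_1=\mathrm{id}_M$, and let $\mathrm{Diff}(M,N)_0=\{F_1\mid F\in \mathrm{Isot}(M,N)_0\}$, a group of diffeomorphisms of $M$. Define $\nu=(\nu_1,\dots,\nu_m):\mathrm{Isot}(M,N)_0\to\mathbb R^m$ by letting $\nu_i(F)=\tilde\gamma(1)-\tilde\gamma(0)$, where $\tilde\gamma:[0,1]\to\mathbb R$ is any continuous lift along $\pi_i$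 of the path $t\mapsto F_t(p_i)$ in $S_i$. Then $A:=\nu(\mathrm{Isot}(M,N)_{\mathrm{id},\mathrm{id}})$ is a subgroup of $\mathbb Z^m\subset\mathbb R^m$, and $\nu$ induces a well-defined map $\widehat\nu:\mathrm{Diff}(M,N)_0\to\mathbb R^m/A$, $\widehat\nu(F_1)=\nu(F)+A$. Suppose $\operatorname{rank}A<m$. Then there is a surjective group homomorphism $\chi:\mathbb R^m/A\to\mathbb R$ such that $\chi\circ\widehat\nu:\mathrm{Diff}(M,N)_0\to\mathbb R$ is a surjective quasimorphism. Here a function $\varphi:G\to\mathbb R$ on a group is a quasimorphism if $\sup_{a,b\in G}|\varphi(ab)-\varphi(a)-\varphi(b)|<\infty$. Moreover, $\mathrm{Diff}(M,N)_0$ is neither bounded nor uniformly perfect. Here a group $G$ is bounded if every conjugation invariant norm $q:G\to[0,\infty)$ on it (that is, $q(g)=0$ iff $g=1$, $q(g^{-1})=q(g)$, $q(gh)\le q(g)+q(h)$ and $q(hgh^{-1})=q(g)$ for all $g,h\in G$) is bounded, and $G$ is uniformly perfect if there is a $k$ such that every element of $G$ is a product of at most $k$ commutators. -/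

import Mathlib

open scoped Manifold ContDiff Topology

noncomputable section

/-! ### Conjugation invariant norms, commutator length, quasimorphisms -/

section Groups

variable {G : Type*} [Group G]

/-- Conjugation invariant norms `q : G → [0, ∞)`. -/
structure IsConjInvariantNorm (q : G → NNReal) : Prop where
  eq_zero_iff : ∀ g, q g = 0 ↔ g = 1
  inv : ∀ g, q g⁻¹ = q g
  mul_le : ∀ g h, q (g * h) ≤ q g + q h
  conj : ∀ g h, q (h * g * h⁻¹) = q g

variable (G) in
/-- A group is bounded if every (finite valued) conjugation invariant norm on it is bounded. -/
def IsBoundedGroup : Prop :=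
  ∀ q : G → NNReal, IsConjInvariantNorm q → ∃ C : NNReal, ∀ g, q g ≤ C

/-- The commutator length: the least number of commutators with product `g`,
and `⊤` if `g` is not a product of commutators. -/
def commutatorLength (g : G) : ℕ∞ :=
  ⨅ l ∈ {l : List G | (∀ x ∈ l, ∃ a b : G, x = a * b * a⁻¹ * b⁻¹) ∧ l.prod = g}, (l.length : ℕ∞)

variable (G) in
/-- A group is uniformly perfect if the commutator length is bounded by a finite number. -/
def IsUniformlyPerfect : Prop :=
  ∃ k : ℕ, ∀ g : G, commutatorLength g ≤ k

/-- Real valued quasimorphisms. -/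
def IsQuasimorphism (φ : G → ℝ) : Prop :=
  ∃ D : ℝ, ∀ a b, |φ (a * b) - φ a - φ b| ≤ D

end Groups

/-! ### Diffeomorphisms and isotopies -/

section Diffeo

/-- Self-diffeomorphisms form a group under composition. -/
instance diffeomorphGroup {E H X : Type*} [NormedAddCommGroup E] [NormedSpace ℝ E]
    [TopologicalSpace H] (J : ModelWithCorners ℝ E H) [TopologicalSpace X] [ChartedSpace H X] :
    Group (X ≃ₘ^∞⟮J, J⟯ X) where
  mul f g := g.trans f
  one := Diffeomorph.refl J X ∞
  inv f := f.symm
  mul_assoc _ _ _ := rfl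
  one_mul _ := rfl
  mul_one _ := rfl
  inv_mul_cancel f := Diffeomorph.ext fun x => f.symm_apply_apply x

variable (n : ℕ) (M : Type*) [TopologicalSpace M] [ChartedSpace (EuclideanSpace ℝ (Fin n)) M]

/-- The group `Diff(M)` of `C^∞` diffeomorphisms of `M`. -/
abbrev Diff : Type _ := M ≃ₘ^∞⟮𝓡 n, 𝓡 n⟯ M

/-- The group `Diff(M × [0, 1])` of `C^∞` diffeomorphisms of the cylinder over `M`. -/
abbrev DiffCylinder : Type _ :=
  (M × unitInterval) ≃ₘ^∞⟮(𝓡 n).prod (𝓡∂ 1), (𝓡 n).prod (𝓡∂ 1)⟯ (M × unitInterval)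

/-- The group `Isot(M)` of `C^∞` isotopies of `M`: the `C^∞` diffeomorphisms of `M × [0, 1]` of the
form `F (x, t) = (F_t x, t)`. -/
def Isot : Subgroup (DiffCylinder n M) where
  carrier := {F | ∀ z, (F z).2 = z.2}
  mul_mem' {F G} hF hG z := (hF (G z)).trans (hG z)
  one_mem' _ := rfl
  inv_mem' {F} hF z := by
    have h := hF (F⁻¹ z)
    rw [show F (F⁻¹ z) = z from F.apply_symm_apply z] at h
    exact h.symm

variable {n M}

theorem Isot.apply_eq (F : Isot n M) (x : M) (t : unitInterval) :
    F.1 (x, t) = ((F.1 (x, t)).1, t) := Prod.ext rfl (F.2 (x, t))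

/-- `F ↦ F_t`, as a homomorphism `Isot(M) → Diff(M)`. -/
def Isot.at (t : unitInterval) : Isot n M →* Diff n M where
  toFun F :=
    { toFun := fun x => (F.1 (x, t)).1
      invFun := fun x => (F⁻¹.1 (x, t)).1
      left_inv := fun x => by
        change (F⁻¹.1 ((F.1 (x, t)).1, t)).1 = x
        rw [← Isot.apply_eq F x t]
        exact congrArg Prod.fst (F.1.symm_apply_apply (x, t))
      right_inv := fun x => by
        change (F.1 ((F⁻¹.1 (x, t)).1, t)).1 = x
        rw [← Isot.apply_eq F⁻¹ x t]
        exact congrArg Prod.fst (F.1.apply_symm_apply (x, t))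
      contMDiff_toFun :=
        contMDiff_fst.comp (F.1.contMDiff.comp (contMDiff_id.prodMk contMDiff_const))
      contMDiff_invFun :=
        contMDiff_fst.comp (F⁻¹.1.contMDiff.comp (contMDiff_id.prodMk contMDiff_const)) }
  map_one' := rfl
  map_mul' F G := Diffeomorph.ext fun x => by
    change (F.1 (G.1 (x, t))).1 = (F.1 ((G.1 (x, t)).1, t)).1
    rw [← Isot.apply_eq G x t]

theorem Isot.at_apply (t : unitInterval) (F : Isot n M) (x : M) :
    Isot.at t F x = (F.1 (x, t)).1 := rfl

variable (n)

/-- The group `Isot(M, N)₀`: isotopies `F` with `F_t(N) = N` for all `t` and `F_0 = id`. -/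
def IsotPairZero (N : Set M) : Subgroup (Isot n M) where
  carrier := {F | (∀ t, Isot.at t F '' N = N) ∧ Isot.at 0 F = 1}
  mul_mem' {F G} hF hG := by
    refine ⟨fun t => ?_, by rw [map_mul, hF.2, hG.2, one_mul]⟩
    have : (Isot.at t (F * G) : M → M) = Isot.at t F ∘ Isot.at t G := by rw [map_mul]; rfl
    rw [this, Set.image_comp, hG.1, hF.1]
  one_mem' := by
    refine ⟨fun t => ?_, map_one _⟩
    have : (Isot.at t (1 : Isot n M) : M → M) = id := by rw [map_one]; rfl
    rw [this, Set.image_id]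
  inv_mem' {F} hF := by
    refine ⟨fun t => ?_, by rw [map_inv, hF.2, inv_one]⟩
    have : (Isot.at t F⁻¹ : M → M) ∘ Isot.at t F = id := by
      funext x; exact (Isot.at t F).symm_apply_apply x
    conv_lhs => rw [← hF.1 t, ← Set.image_comp, this, Set.image_id]

/-- The homomorphism `R : Isot(M, N)₀ → Diff(M)`, `R F = F_1`. -/
def endMap (N : Set M) : IsotPairZero n N →* Diff n M :=
  (Isot.at 1).comp (IsotPairZero n N).subtype

/-- The group `Diff(M, N)₀ = R(Isot(M, N)₀)`. -/
def DiffPairZero (N : Set M) : Subgroup (Diff n M) := (endMap n N).range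

/-- The group `Isot(M, N)_{id, id}` of isotopies in `Isot(M, N)₀` that also end at the identity. -/
def IsotPairLoop (N : Set M) : Subgroup (IsotPairZero n N) := (endMap n N).ker

end Diffeo

/-! ### Circles in a manifold and rotation angles -/

/-- A family of `m` pairwise disjoint smoothly embedded circles `S_i` in `M`, each with a
parametrization by the standard circle and a distinguished point. -/
structure CircleFamily (n m : ℕ) (M : Type*) [TopologicalSpace M]
    [ChartedSpace (EuclideanSpace ℝ (Fin n)) M] where
  param : Fin m → Circle → M
  isSmoothEmbedding : ∀ i, Manifold.IsSmoothEmbedding (𝓡 1) (𝓡 n) ∞ (param i)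
  disjoint : ∀ i j, i ≠ j → Disjoint (Set.range (param i)) (Set.range (param j))
  base : Fin m → Circle

namespace CircleFamily

variable {n m : ℕ} {M : Type*} [TopologicalSpace M] [ChartedSpace (EuclideanSpace ℝ (Fin n)) M]
  (S : CircleFamily n m M)

/-- The union `N` of the circles `S_i`. -/
def union : Set M := ⋃ i, Set.range (S.param i)

/-- The distinguished point `p_i` of `S_i`. -/
def point (i : Fin m) : M := S.param i (S.base i)

/-- The universal covering `π_i : ℝ → ℝ/ℤ ≅ S_i`. -/
def cover (i : Fin m) (x : ℝ) : M := S.param i (Circle.exp (2 * Real.pi * x))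

open Classical in
/-- The rotation angle of a path `γ` in `S_i`: the number `γ'(1) - γ'(0)` for any continuous lift
`γ' : [0, 1] → ℝ` of `γ` along `π_i` (see `exists_lift` and `rotationAngle_eq`). -/
def rotationAngle (i : Fin m) (γ : unitInterval → M) : ℝ :=
  if h : ∃ g : C(unitInterval, ℝ), ∀ t, S.cover i (g t) = γ t then
    h.choose 1 - h.choose 0
  else 0

/-- The map `ν : Isot(M, N)₀ → ℝ^m`, whose `i`-th component is the rotation angle of the path
`t ↦ F_t(p_i)` in `S_i`. -/
def nu (F : IsotPairZero n S.union) : Fin m → ℝ :=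
  fun i => S.rotationAngle i fun t => Isot.at t F.1 (S.point i)

/-! #### Facts needed to see that `Im ν|` is a group and that `ν` induces a map on `Diff(M, N)₀` -/

theorem cover_eq_iff (i : Fin m) (x y : ℝ) :
    S.cover i x = S.cover i y ↔ ∃ k : ℤ, x = y + k := by
  unfold cover
  rw [(S.isSmoothEmbedding i).isEmbedding.injective.eq_iff, Circle.exp_eq_exp]
  refine exists_congr fun k => ?_
  have := Real.pi_pos
  constructor
  · intro h
    have h' : 2 * Real.pi * (x - (y + k)) = 0 := by rw [mul_sub, h]; ring
    have h2 := (mul_eq_zero.1 h').resolve_left (by positivity)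
    linarith
  · rintro rfl; ring

theorem continuous_cover (i : Fin m) : Continuous (S.cover i) :=
  (S.isSmoothEmbedding i).isEmbedding.continuous.comp
    (Circle.exp.continuous.comp (continuous_const.mul continuous_id))

theorem cover_surj (i : Fin m) (z : Circle) : ∃ x, S.cover i x = S.param i z := by
  refine ⟨Complex.arg z / (2 * Real.pi), ?_⟩
  unfold cover
  rw [mul_div_cancel₀ _ (by positivity), Circle.exp_arg]

/-- Maps into `S_i` from simply connected locally path connected spaces lift along `π_i`. -/
theorem exists_lift {A : Type*} [TopologicalSpace A] [SimplyConnectedSpace A]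
    [LocallyPathConnectedSpace A] (i : Fin m) (f : A → M) (hf : Continuous f)
    (hr : ∀ a, f a ∈ Set.range (S.param i)) (a₀ : A) (e₀ : ℝ) (h₀ : S.cover i e₀ = f a₀) :
    ∃ g : C(A, ℝ), g a₀ = e₀ ∧ ∀ a, S.cover i (g a) = f a := by
  have hemb := (S.isSmoothEmbedding i).isEmbedding
  choose c hc using hr
  have hcc : Continuous c := by
    rw [hemb.continuous_iff]
    exact hf.congr fun a => (hc a).symm
  have hpi : (2 * Real.pi) ≠ 0 := by positivity
  obtain ⟨g, ⟨hg0, hg⟩, -⟩ := Circle.isCoveringMap_exp.existsUnique_continuousMap_lifts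
    (⟨c, hcc⟩ : C(A, Circle)) a₀ (2 * Real.pi * e₀) (hemb.injective (by
      change S.cover i e₀ = S.param i (c a₀); rw [h₀, hc]))
  refine ⟨⟨fun a => g a / (2 * Real.pi), by fun_prop⟩, ?_, fun a => ?_⟩
  · change g a₀ / (2 * Real.pi) = e₀
    rw [hg0, mul_div_cancel_left₀ _ hpi]
  · change S.param i (Circle.exp (2 * Real.pi * (g a / (2 * Real.pi)))) = f a
    rw [mul_div_cancel₀ _ hpi, ← hc a]
    exact congrArg (S.param i) (congrFun hg a)

/-- Two lifts along `π_i` over a connected space differ by a constant. -/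
theorem lift_sub_eq {A : Type*} [TopologicalSpace A] [PreconnectedSpace A] (i : Fin m)
    (g h : C(A, ℝ)) (H : ∀ a, S.cover i (g a) = S.cover i (h a)) (a b : A) :
    g a - g b = h a - h b := by
  choose k hk using fun a => (S.cover_eq_iff i (g a) (h a)).1 (H a)
  have hkc : Continuous k := by
    rw [Int.isClosedEmbedding_coe_real.isEmbedding.continuous_iff]
    have : (fun a => ((k a : ℤ) : ℝ)) = fun a => g a - h a := by
      funext a; rw [hk a]; ring
    change Continuous fun a => ((k a : ℤ) : ℝ)
    rw [this]
    fun_prop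
  have hab : k a = k b := PreconnectedSpace.constant ‹_› hkc
  rw [hk a, hk b, hab]; ring

/-- The rotation angle does not depend on the lift. -/
theorem rotationAngle_eq (i : Fin m) (γ : unitInterval → M) (g : C(unitInterval, ℝ))
    (hg : ∀ t, S.cover i (g t) = γ t) : S.rotationAngle i γ = g 1 - g 0 := by
  have h : ∃ g : C(unitInterval, ℝ), ∀ t, S.cover i (g t) = γ t := ⟨g, hg⟩
  unfold rotationAngle
  rw [dif_pos h]
  exact S.lift_sub_eq i _ _ (fun t => (h.choose_spec t).trans (hg t).symm) 1 0

/-- A connected set of points of `N` which meets `S_i` lies in `S_i`. -/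
theorem mem_range_of_preconnected [T2Space M] {A : Type*} [TopologicalSpace A]
    [PreconnectedSpace A] (i : Fin m) (f : A → M) (hf : Continuous f)
    (hN : ∀ a, f a ∈ S.union) (a₀ : A) (h₀ : f a₀ ∈ Set.range (S.param i)) (a : A) :
    f a ∈ Set.range (S.param i) := by
  have hclosed : ∀ j, IsClosed (Set.range (S.param j)) := fun j =>
    (isCompact_range (S.isSmoothEmbedding j).isEmbedding.continuous).isClosed
  have hcl : IsClopen (f ⁻¹' Set.range (S.param i)) := by
    refine ⟨(hclosed i).preimage hf, ?_⟩
    have : f ⁻¹' Set.range (S.param i) =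
        (⋃ j ∈ {j : Fin m | j ≠ i}, f ⁻¹' Set.range (S.param j))ᶜ := by
      ext b
      simp only [Set.mem_compl_iff, Set.mem_iUnion, not_exists]
      constructor
      · intro hb j hj hb'
        exact Set.disjoint_left.1 (S.disjoint j i hj) hb' hb
      · intro hb
        obtain ⟨j, hj⟩ := Set.mem_iUnion.1 (hN b)
        by_cases hji : j = i
        · exact hji ▸ hj
        · exact absurd hj (hb j hji)
    rw [this]
    exact (Set.Finite.isClosed_biUnion (Set.toFinite _)
      fun j _ => (hclosed j).preimage hf).isOpen_compl
  have h : a ∈ f ⁻¹' Set.range (S.param i) := by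
    rw [hcl.eq_univ ⟨a₀, h₀⟩]; exact Set.mem_univ a
  exact h

theorem at_mem_union (F : IsotPairZero n S.union) (t : unitInterval) {x : M} (hx : x ∈ S.union) :
    Isot.at t F.1 x ∈ S.union := by
  have h := Set.mem_image_of_mem (Isot.at t F.1) hx
  rwa [F.2.1 t] at h

theorem continuous_at (F : IsotPairZero n S.union) :
    Continuous fun z : unitInterval × M => Isot.at z.1 F.1 z.2 := by
  have := F.1.1.continuous
  exact continuous_fst.comp (this.comp (continuous_snd.prodMk continuous_fst))

theorem cover_mem_union (i : Fin m) (x : ℝ) : S.cover i x ∈ S.union :=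
  Set.mem_iUnion.2 ⟨i, _, rfl⟩

theorem cover_mem_range (i : Fin m) (x : ℝ) : S.cover i x ∈ Set.range (S.param i) := ⟨_, rfl⟩

theorem exists_lift_at [T2Space M] (F : IsotPairZero n S.union) (i : Fin m) (b : ℝ)
    (hb : S.cover i b = S.point i) :
    ∃ f : C(unitInterval, ℝ), f 0 = b ∧ ∀ t, S.cover i (f t) = Isot.at t F.1 (S.point i) := by
  have : LocallyPathConnectedSpace unitInterval :=
    (convex_Icc (0 : ℝ) 1).locallyPathConnectedSpace
  have : ContractibleSpace unitInterval :=
    (convex_Icc (0 : ℝ) 1).contractibleSpace ⟨0, by simp⟩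
  have hF0 : ∀ x, Isot.at 0 F.1 x = x := fun x => by rw [F.2.2]; rfl
  have hf : Continuous fun t => Isot.at t F.1 (S.point i) :=
    (S.continuous_at F).comp (continuous_id.prodMk continuous_const)
  exact S.exists_lift i (fun t => Isot.at t F.1 (S.point i)) hf
    (S.mem_range_of_preconnected i _ hf
      (fun t => S.at_mem_union F t (hb ▸ S.cover_mem_union i b)) 0
      (by rw [hF0, ← hb]; exact S.cover_mem_range i b)) 0 b (by rw [hF0, hb])

theorem nu_mul [T2Space M] (G F : IsotPairZero n S.union) (hG : G ∈ IsotPairLoop n S.union) :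
    S.nu (G * F) = S.nu G + S.nu F := by
  have : LocallyPathConnectedSpace unitInterval :=
    (convex_Icc (0 : ℝ) 1).locallyPathConnectedSpace
  have : ContractibleSpace unitInterval :=
    (convex_Icc (0 : ℝ) 1).contractibleSpace ⟨0, by simp⟩
  have hG0 : ∀ x, Isot.at 0 G.1 x = x := fun x => by rw [G.2.2]; rfl
  have hG1 : ∀ x, Isot.at 1 G.1 x = x := fun x => by
    have h : Isot.at 1 G.1 = 1 := hG
    rw [h]; rfl
  funext i
  obtain ⟨b, hb⟩ := S.cover_surj i (S.base i)
  have hb : S.cover i b = S.point i := hb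
  have hcG := S.continuous_at G
  have hc := S.continuous_cover i
  obtain ⟨f, hf0, hfl⟩ := S.exists_lift_at F i b hb
  have hH : Continuous fun z : unitInterval × unitInterval =>
      Isot.at z.1 G.1 (S.cover i (f z.2)) :=
    hcG.comp (continuous_fst.prodMk (hc.comp (f.continuous.comp continuous_snd)))
  obtain ⟨K, hK0, hKl⟩ := S.exists_lift i
    (fun z : unitInterval × unitInterval => Isot.at z.1 G.1 (S.cover i (f z.2))) hH
    (S.mem_range_of_preconnected i _ hH
      (fun z => S.at_mem_union G z.1 (S.cover_mem_union i _)) (0, 0)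
      (by rw [hG0]; exact S.cover_mem_range i _)) (0, 0) b (by rw [hG0, hf0])
  let K0 : C(unitInterval, ℝ) := ⟨fun t => K (0, t), by fun_prop⟩
  let K1 : C(unitInterval, ℝ) := ⟨fun t => K (1, t), by fun_prop⟩
  let L0 : C(unitInterval, ℝ) := ⟨fun t => K (t, 0), by fun_prop⟩
  let Kd : C(unitInterval, ℝ) := ⟨fun t => K (t, t), by fun_prop⟩
  have e0 : K (0, 1) - K (0, 0) = f 1 - f 0 :=
    S.lift_sub_eq i K0 f (fun t => (hKl (0, t)).trans (hG0 _)) 1 0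
  have e1 : K (1, 1) - K (1, 0) = f 1 - f 0 :=
    S.lift_sub_eq i K1 f (fun t => (hKl (1, t)).trans (hG1 _)) 1 0
  have nF : S.nu F i = f 1 - f 0 := S.rotationAngle_eq i _ f hfl
  have nG : S.nu G i = K (1, 0) - K (0, 0) := S.rotationAngle_eq i _ L0 fun t => by
    rw [← hb, ← hf0]; exact hKl (t, 0)
  have nGF : S.nu (G * F) i = K (1, 1) - K (0, 0) := S.rotationAngle_eq i _ Kd fun t => by
    refine (hKl (t, t)).trans ?_
    change Isot.at t G.1 (S.cover i (f t)) = Isot.at t (G.1 * F.1) (S.point i)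
    rw [hfl t, map_mul]; rfl
  rw [Pi.add_apply, nF, nG, nGF]
  linarith

theorem nu_one [T2Space M] : S.nu 1 = 0 := by
  have h := S.nu_mul 1 1 (one_mem _)
  rw [one_mul] at h
  exact left_eq_add.1 h

/-- The subgroup `A = ν(Isot(M, N)_{id, id})` of `ℝ^m` (it is contained in `ℤ^m`). -/
def periodGroup [T2Space M] : AddSubgroup (Fin m → ℝ) where
  carrier := {a | ∃ F ∈ IsotPairLoop n S.union, S.nu F = a}
  add_mem' := by
    rintro _ _ ⟨F, hF, rfl⟩ ⟨G, hG, rfl⟩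
    exact ⟨F * G, mul_mem hF hG, S.nu_mul F G hF⟩
  zero_mem' := ⟨1, one_mem _, S.nu_one⟩
  neg_mem' := by
    rintro _ ⟨F, hF, rfl⟩
    refine ⟨F⁻¹, inv_mem hF, ?_⟩
    have h := S.nu_mul F⁻¹ F (inv_mem hF)
    rw [inv_mul_cancel, nu_one] at h
    exact (neg_eq_of_add_eq_zero_left h.symm).symm

theorem periodGroup_le_int [T2Space M] {a : Fin m → ℝ} (ha : a ∈ S.periodGroup) (i : Fin m) :
    ∃ k : ℤ, a i = k := by
  obtain ⟨F, hF, rfl⟩ := ha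
  obtain ⟨b, hb⟩ := S.cover_surj i (S.base i)
  have hb : S.cover i b = S.point i := hb
  obtain ⟨f, hf0, hfl⟩ := S.exists_lift_at F i b hb
  have hF1 : Isot.at 1 F.1 = 1 := hF
  have h1 : S.cover i (f 1) = S.cover i b := by rw [hfl, hF1, hb]; rfl
  obtain ⟨k, hk⟩ := (S.cover_eq_iff i _ _).1 h1
  refine ⟨k, (S.rotationAngle_eq i _ f hfl).trans ?_⟩
  rw [hf0, hk]; ring

/-- The map `ν̂ : Diff(M, N)₀ → ℝ^m / A`, `ν̂ f = ν F + A` for any `F ∈ Isot(M, N)₀` with `F_1 = f`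
(see `nuHat_endMap` for the independence of `F`). -/
def nuHat [T2Space M] (f : DiffPairZero n S.union) : (Fin m → ℝ) ⧸ S.periodGroup :=
  QuotientAddGroup.mk (S.nu (MonoidHom.mem_range.1 f.2).choose)

theorem nuHat_endMap [T2Space M] (F : IsotPairZero n S.union) :
    S.nuHat ⟨endMap n S.union F, F, rfl⟩ = QuotientAddGroup.mk (S.nu F) := by
  have hr : endMap n S.union F ∈ (endMap n S.union).range := ⟨F, rfl⟩
  obtain ⟨G, hG⟩ : ∃ G, G = (MonoidHom.mem_range.1 hr).choose := ⟨_, rfl⟩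
  have hGF : endMap n S.union G = endMap n S.union F := by
    rw [hG]; exact (MonoidHom.mem_range.1 hr).choose_spec
  have hloop : F * G⁻¹ ∈ IsotPairLoop n S.union := by
    change endMap n S.union (F * G⁻¹) = 1
    rw [map_mul, map_inv, hGF, mul_inv_cancel]
  have h := S.nu_mul (F * G⁻¹) G hloop
  rw [inv_mul_cancel_right] at h
  change (QuotientAddGroup.mk (S.nu (MonoidHom.mem_range.1 hr).choose) :
    (Fin m → ℝ) ⧸ S.periodGroup) = _
  rw [← hG, QuotientAddGroup.eq]
  refine ⟨F * G⁻¹, hloop, ?_⟩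
  rw [h]; abel

end CircleFamily

end

/-! Each coordinate of `ν` behaves like a translation number. An isotopy from the identity that
preserves `N` preserves each circle, and lifts there to monotone maps of `ℝ` commuting with integer
translations. The displacement of such a map varies by at most 1 over `ℝ`, so every `ν_i` has defect
at most 1 (`abs_nu_mul_sub_le`). Since `rank A < m`, the real span of `A` is a proper subspace, and
some nonzero linear functional `l` kills `A` (`exists_dual_ne_zero_of_rank_lt`). It descends to `χ`,
and `χ ∘ ν̂` is a quasimorphism with defect at most the sum of the absolute values of the
coefficients of `l`. For surjectivity, bump function pushes in charts that straighten `S_i` move a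
point to all nearby points of the circle; connectedness of `ℝ` turns this into arbitrary rotation
angles on one circle with the others fixed (`reaches`, `exists_nu_eq_single`). Finally, an unbounded
quasimorphism excludes uniform perfectness, being bounded on products of `k` commutators, and
excludes boundedness, since it yields an unbounded conjugation invariant norm. -/

/-! ### Unbounded quasimorphisms as obstructions. -/

namespace IsQuasimorphism

variable {G : Type*} [Group G] {φ : G → ℝ}

theorem exists_nonneg_bound (hφ : IsQuasimorphism φ) :
    ∃ D : ℝ, 0 ≤ D ∧ ∀ a b, |φ (a * b) - φ a - φ b| ≤ D := by
  obtain ⟨D, hD⟩ := hφ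
  exact ⟨D, (abs_nonneg _).trans (hD 1 1), hD⟩

variable {D : ℝ}

theorem abs_one_le (hD : ∀ a b, |φ (a * b) - φ a - φ b| ≤ D) : |φ 1| ≤ D := by
  have h := hD 1 1
  rw [mul_one, sub_self, zero_sub, abs_neg] at h
  exact h

theorem abs_add_inv_le (hD : ∀ a b, |φ (a * b) - φ a - φ b| ≤ D) (g : G) :
    |φ g + φ g⁻¹| ≤ 2 * D := by
  have h1 := hD g g⁻¹
  have h2 := abs_one_le hD
  rw [mul_inv_cancel] at h1
  rw [abs_le] at *
  constructor <;> linarith [h1.1, h1.2, h2.1, h2.2]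

theorem abs_conj_sub_le (hD : ∀ a b, |φ (a * b) - φ a - φ b| ≤ D) (g h : G) :
    |φ (h * g * h⁻¹) - φ g| ≤ 4 * D := by
  have h1 := hD (h * g) h⁻¹
  have h2 := hD h g
  have h3 := abs_add_inv_le hD h
  rw [abs_le] at *
  constructor <;> linarith [h1.1, h1.2, h2.1, h2.2, h3.1, h3.2]

/-- The conjugate `a * b * a⁻¹` has nearly the value of `b`, which cancels that of `b⁻¹`: the cost
is `4 * D + 2 * D + D`. -/
theorem abs_commutator_le (hD : ∀ a b, |φ (a * b) - φ a - φ b| ≤ D) (a b : G) :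
    |φ (a * b * a⁻¹ * b⁻¹)| ≤ 7 * D := by
  have h1 := hD (a * b * a⁻¹) b⁻¹
  have h2 := abs_conj_sub_le hD b a
  have h3 := abs_add_inv_le hD b
  rw [abs_le] at *
  constructor <;> linarith [h1.1, h1.2, h2.1, h2.2, h3.1, h3.2]

/-- Each commutator costs `7 * D` and each multiplication a further `D`; the leading `D` pays for
the empty product. -/
theorem abs_prod_commutators_le (hD : ∀ a b, |φ (a * b) - φ a - φ b| ≤ D) (l : List G)
    (hl : ∀ x ∈ l, ∃ a b : G, x = a * b * a⁻¹ * b⁻¹) :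
    |φ l.prod| ≤ D + l.length * (8 * D) := by
  induction l with
  | nil => simpa using abs_one_le hD
  | cons x l ih =>
    have h1 := ih fun y hy => hl y (List.mem_cons_of_mem x hy)
    obtain ⟨a, b, rfl⟩ := hl x List.mem_cons_self
    have h2 := abs_commutator_le hD a b
    have h3 := hD (a * b * a⁻¹ * b⁻¹) l.prod
    rw [List.prod_cons, List.length_cons]
    push_cast
    rw [abs_le] at *
    constructor <;> nlinarith [h1.1, h1.2, h2.1, h2.2, h3.1, h3.2]

theorem not_isUniformlyPerfect (hφ : IsQuasimorphism φ) (hu : ∀ C, ∃ g, C < |φ g|) :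
    ¬ IsUniformlyPerfect G := by
  rintro ⟨k, hk⟩
  obtain ⟨D, hD0, hD⟩ := hφ.exists_nonneg_bound
  obtain ⟨g, hg⟩ := hu (D + k * (8 * D))
  -- A strict bound on the infimum produces an actual list of commutators.
  have h : commutatorLength g < (k + 1 : ℕ) := (hk g).trans_lt (by exact_mod_cast k.lt_succ_self)
  simp only [commutatorLength, iInf_lt_iff] at h
  obtain ⟨l, ⟨hl, rfl⟩, hlk⟩ := h
  have hlen : l.length ≤ k := Nat.lt_succ_iff.1 (by exact_mod_cast hlk)
  have h1 := abs_prod_commutators_le hD l hl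
  have h2 : (l.length : ℝ) * (8 * D) ≤ k * (8 * D) := by gcongr
  linarith

/-- The supremum of `|φ|` over the conjugates of `g` and of `g⁻¹`. -/
noncomputable def conjSup (φ : G → ℝ) (g : G) : ℝ :=
  ⨆ h, max |φ (h * g * h⁻¹)| |φ (h * g⁻¹ * h⁻¹)|

theorem bddAbove_conj (hD : ∀ a b, |φ (a * b) - φ a - φ b| ≤ D) (g : G) :
    BddAbove (Set.range fun h => max |φ (h * g * h⁻¹)| |φ (h * g⁻¹ * h⁻¹)|) := by
  refine ⟨max (|φ g| + 4 * D) (|φ g⁻¹| + 4 * D), ?_⟩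
  rintro _ ⟨h, rfl⟩
  refine max_le_max ?_ ?_
  · linarith [abs_conj_sub_le hD g h, abs_sub_abs_le_abs_sub (φ (h * g * h⁻¹)) (φ g)]
  · linarith [abs_conj_sub_le hD g⁻¹ h, abs_sub_abs_le_abs_sub (φ (h * g⁻¹ * h⁻¹)) (φ g⁻¹)]

theorem conjSup_nonneg (g : G) : 0 ≤ conjSup φ g :=
  Real.iSup_nonneg fun _ => (abs_nonneg _).trans (le_max_left _ _)

theorem conjSup_inv (g : G) : conjSup φ g⁻¹ = conjSup φ g := by
  unfold conjSup
  simp only [inv_inv, max_comm]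

theorem conjSup_conj (g h : G) : conjSup φ (h * g * h⁻¹) = conjSup φ g := by
  unfold conjSup
  refine (Equiv.mulRight h).iSup_congr fun k => ?_
  simp only [Equiv.coe_mulRight]
  group

theorem conjSup_mul_le (hD : ∀ a b, |φ (a * b) - φ a - φ b| ≤ D) (g h : G) :
    conjSup φ (g * h) ≤ conjSup φ g + conjSup φ h + D := by
  have key : ∀ a b : G, |φ (a * b)| ≤ |φ a| + |φ b| + D := fun a b => by
    have h1 := hD a b
    have h2 := abs_sub_abs_le_abs_sub (φ (a * b)) (φ a + φ b)
    rw [← sub_sub] at h2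
    linarith [abs_add_le (φ a) (φ b)]
  refine ciSup_le fun k => ?_
  have hg := le_ciSup (bddAbove_conj hD g) k
  have hh := le_ciSup (bddAbove_conj hD h) k
  have e1 : k * (g * h) * k⁻¹ = (k * g * k⁻¹) * (k * h * k⁻¹) := by group
  have e2 : k * (g * h)⁻¹ * k⁻¹ = (k * h⁻¹ * k⁻¹) * (k * g⁻¹ * k⁻¹) := by group
  rw [e1, e2]
  unfold conjSup
  refine max_le ((key _ _).trans ?_) ((key _ _).trans ?_)
  · linarith [(le_max_left _ _).trans hg, (le_max_left _ _).trans hh]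
  · linarith [(le_max_right _ _).trans hg, (le_max_right _ _).trans hh]

theorem not_isBoundedGroup (hφ : IsQuasimorphism φ) (hu : ∀ C, ∃ g, C < |φ g|) :
    ¬ IsBoundedGroup G := by
  classical
  intro hb
  obtain ⟨D, hD0, hD⟩ := hφ.exists_nonneg_bound
  have hpos : ∀ g, 0 < conjSup φ g + D + 1 := fun g => by linarith [conjSup_nonneg (φ := φ) g]
  -- `conjSup` is subadditive only up to `D`; adding `D` away from the identity absorbs this defect,
  -- and adding 1 keeps the value positive.
  let q : G → NNReal := fun g => if g = 1 then 0 else ⟨conjSup φ g + D + 1, (hpos g).le⟩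
  have hq1 : q 1 = 0 := if_pos rfl
  have hq : ∀ g, g ≠ 1 → (q g : ℝ) = conjSup φ g + D + 1 := fun g hg =>
    congrArg NNReal.toReal (if_neg hg)
  have hnorm : IsConjInvariantNorm q := by
    refine ⟨fun g => ⟨fun h => ?_, fun h => h ▸ hq1⟩, fun g => ?_, fun g h => ?_, fun g h => ?_⟩
    · by_contra hg
      exact (hpos g).ne' (by rw [← hq g hg, h, NNReal.coe_zero])
    · simp only [q, inv_eq_one, conjSup_inv]
    · by_cases hg : g = 1
      · rw [hg, one_mul, hq1, zero_add]
      by_cases hh : h = 1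
      · rw [hh, mul_one, hq1, add_zero]
      by_cases hgh : g * h = 1
      · rw [hgh, hq1]; exact zero_le
      rw [← NNReal.coe_le_coe, NNReal.coe_add, hq _ hg, hq _ hh, hq _ hgh]
      linarith [conjSup_mul_le hD g h]
    · simp only [q, conj_eq_one_iff, conjSup_conj]
  obtain ⟨C, hC⟩ := hb q hnorm
  -- Exceeding `D` forces `g ≠ 1`, where `q` is given by the formula; exceeding `C` gives the
  -- contradiction.
  obtain ⟨g, hg⟩ := hu (max C D)
  have hg1 : g ≠ 1 := by
    rintro rfl
    linarith [abs_one_le hD, le_max_right (C : ℝ) D]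
  have h1 : (q g : ℝ) ≤ C := by exact_mod_cast hC g
  have h2 := le_ciSup (bddAbove_conj hD g) 1
  simp only [one_mul, inv_one, mul_one] at h2
  rw [hq g hg1, conjSup] at h1
  linarith [le_max_left (C : ℝ) D, le_max_left |φ g| |φ g⁻¹|]

end IsQuasimorphism

/-! ### Lifts of isotopies to the line and the defect of `ν`. -/

namespace CircleFamily

variable {n m : ℕ} {M : Type*} [TopologicalSpace M] [ChartedSpace (EuclideanSpace ℝ (Fin n)) M]
  (S : CircleFamily n m M)

instance locallyPathConnectedSpace_unitInterval : LocallyPathConnectedSpace unitInterval :=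
  (convex_Icc (0 : ℝ) 1).locallyPathConnectedSpace

instance contractibleSpace_unitInterval : ContractibleSpace unitInterval :=
  (convex_Icc (0 : ℝ) 1).contractibleSpace ⟨0, by simp⟩

theorem at_zero_apply (F : IsotPairZero n S.union) (x : M) : Isot.at 0 F.1 x = x := by
  rw [F.2.2]; rfl

theorem cover_add_int (i : Fin m) (x : ℝ) (k : ℤ) : S.cover i (x + k) = S.cover i x :=
  (S.cover_eq_iff i _ _).2 ⟨k, rfl⟩

/-- An isotopy which starts at the identity and preserves the circles lifts to `ℝ × [0, 1]`. -/
theorem exists_lift_isot [T2Space M] (F : IsotPairZero n S.union) (i : Fin m) :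
    ∃ L : C(unitInterval × ℝ, ℝ), (∀ x, L (0, x) = x) ∧
      ∀ t x, S.cover i (L (t, x)) = Isot.at t F.1 (S.cover i x) := by
  have hf : Continuous fun z : unitInterval × ℝ => Isot.at z.1 F.1 (S.cover i z.2) :=
    (S.continuous_at F).comp
      (continuous_fst.prodMk ((S.continuous_cover i).comp continuous_snd))
  obtain ⟨L, h0, hL⟩ := S.exists_lift i (fun z => Isot.at z.1 F.1 (S.cover i z.2)) hf
    (S.mem_range_of_preconnected i _ hf (fun z => S.at_mem_union F z.1 (S.cover_mem_union i _))
      (0, 0) (by rw [S.at_zero_apply]; exact S.cover_mem_range i _)) (0, 0) 0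
    (by rw [S.at_zero_apply])
  refine ⟨L, fun x => ?_, fun t x => hL (t, x)⟩
  -- At time 0 both `L` and the identity lift `π_i`, and they agree at 0.
  have h := S.lift_sub_eq i (⟨fun x => L (0, x), by fun_prop⟩ : C(ℝ, ℝ)) (ContinuousMap.id ℝ)
    (fun x => (hL (0, x)).trans (S.at_zero_apply F _)) x 0
  simp only [ContinuousMap.coe_mk, h0, sub_zero, ContinuousMap.id_apply] at h
  exact h

variable {S} in
-- As functions of `t` both sides lift the same path, and they agree at `t = 0`.
theorem lift_add_int {F : IsotPairZero n S.union} {i : Fin m} {L : C(unitInterval × ℝ, ℝ)}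
    (h0 : ∀ x, L (0, x) = x)
    (hL : ∀ t x, S.cover i (L (t, x)) = Isot.at t F.1 (S.cover i x)) (t : unitInterval) (x : ℝ)
    (k : ℤ) : L (t, x + k) = L (t, x) + k := by
  have h := S.lift_sub_eq i (⟨fun t => L (t, x + k), by fun_prop⟩ : C(unitInterval, ℝ))
    ⟨fun t => L (t, x), by fun_prop⟩ (fun t => by
      simp only [ContinuousMap.coe_mk, hL, cover_add_int]) t 0
  simp only [ContinuousMap.coe_mk, h0] at h
  linarith

variable {S} in
-- Distinct points of the circle cannot collide, because `F_t` is injective.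
theorem lift_sub_ne_int {F : IsotPairZero n S.union} {i : Fin m} {L : C(unitInterval × ℝ, ℝ)}
    (hL : ∀ t x, S.cover i (L (t, x)) = Isot.at t F.1 (S.cover i x)) {x y : ℝ}
    (h1 : x < y) (h2 : y < x + 1) (t : unitInterval) (k : ℤ) : L (t, y) - L (t, x) ≠ k := by
  intro h
  have hc : S.cover i (L (t, y)) = S.cover i (L (t, x)) :=
    (S.cover_eq_iff i _ _).2 ⟨k, by linarith⟩
  rw [hL, hL] at hc
  obtain ⟨l, hl⟩ := (S.cover_eq_iff i _ _).1 ((Isot.at t F.1).injective hc)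
  have a1 : (0 : ℝ) < l := by linarith
  have a2 : (l : ℝ) < 1 := by linarith
  have b1 : 0 < l := by exact_mod_cast a1
  have b2 : l < 1 := by exact_mod_cast a2
  omega

variable {S} in
/-- The lift of an isotopy is monotone, and moves all points by nearly the same amount. -/
theorem lift_sub_mem_Ioo {F : IsotPairZero n S.union} {i : Fin m} {L : C(unitInterval × ℝ, ℝ)}
    (h0 : ∀ x, L (0, x) = x)
    (hL : ∀ t x, S.cover i (L (t, x)) = Isot.at t F.1 (S.cover i x)) {x y : ℝ}
    (h1 : x < y) (h2 : y < x + 1) (t : unitInterval) :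
    L (t, y) - L (t, x) ∈ Set.Ioo (0 : ℝ) 1 := by
  have hc : Continuous fun t : unitInterval => L (t, y) - L (t, x) := by fun_prop
  have hne := lift_sub_ne_int hL h1 h2
  constructor
  · by_contra! h
    -- The difference starts at `y - x` in `(0, 1)`, so leaving this interval would mean crossing an
    -- integer at some time.
    obtain ⟨s, hs⟩ := mem_range_of_exists_le_of_exists_ge hc ⟨t, h⟩
      ⟨0, by simp only [h0]; linarith⟩
    exact hne s 0 (by rw [Int.cast_zero]; exact hs)
  · by_contra! h
    obtain ⟨s, hs⟩ := mem_range_of_exists_le_of_exists_ge hc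
      ⟨0, by simp only [h0]; linarith⟩ ⟨t, h⟩
    exact hne s 1 (by rw [Int.cast_one]; exact hs)

variable {S} in
theorem abs_displacement_sub_le {F : IsotPairZero n S.union} {i : Fin m}
    {L : C(unitInterval × ℝ, ℝ)} (h0 : ∀ x, L (0, x) = x)
    (hL : ∀ t x, S.cover i (L (t, x)) = Isot.at t F.1 (S.cover i x)) (x y : ℝ)
    (t : unitInterval) : |(L (t, y) - y) - (L (t, x) - x)| ≤ 1 := by
  -- The displacement is 1-periodic, so `y` may be replaced by its translate `z` in `[x, x + 1)`.
  have hy : L (t, y) - y = L (t, y + (-⌊y - x⌋ : ℤ)) - (y + (-⌊y - x⌋ : ℤ)) := by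
    rw [lift_add_int h0 hL]; ring
  have a1 := Int.floor_le (y - x)
  have a2 := Int.lt_floor_add_one (y - x)
  rw [hy]
  obtain ⟨z, hz⟩ : ∃ z, z = y + (-⌊y - x⌋ : ℤ) := ⟨_, rfl⟩
  rw [← hz]
  push_cast at hz
  rcases eq_or_lt_of_le (show x ≤ z by linarith) with rfl | h
  · simp
  · have := lift_sub_mem_Ioo h0 hL h (by linarith) t
    rw [abs_le]
    constructor <;> linarith [this.1, this.2]

theorem nu_eq [T2Space M] (F : IsotPairZero n S.union) (i : Fin m) {b : ℝ}
    (hb : S.cover i b = S.point i) {g : C(unitInterval, ℝ)} (h0 : g 0 = b)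
    (hg : ∀ t, S.cover i (g t) = Isot.at t F.1 (S.cover i b)) : S.nu F i = g 1 - b := by
  rw [← h0]
  exact S.rotationAngle_eq i _ g fun t => by rw [hg, hb]

/-- The composite of the lifts `L` and `K` lifts `F * G`, so the defect compares the displacements
of `L` at time 1 at the points `K (1, b)` and `b`. -/
theorem abs_nu_mul_sub_le [T2Space M] (F G : IsotPairZero n S.union) (i : Fin m) :
    |S.nu (F * G) i - S.nu F i - S.nu G i| ≤ 1 := by
  obtain ⟨b, hb⟩ := S.cover_surj i (S.base i)
  have hb : S.cover i b = S.point i := hb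
  obtain ⟨L, L0, hL⟩ := S.exists_lift_isot F i
  obtain ⟨K, K0, hK⟩ := S.exists_lift_isot G i
  have e1 := S.nu_eq F i hb (g := ⟨fun t => L (t, b), by fun_prop⟩) (L0 b) fun t => hL t b
  have e2 := S.nu_eq G i hb (g := ⟨fun t => K (t, b), by fun_prop⟩) (K0 b) fun t => hK t b
  have e3 := S.nu_eq (F * G) i hb (g := ⟨fun t => L (t, K (t, b)), by fun_prop⟩)
    (by simp only [ContinuousMap.coe_mk, K0, L0]) fun t => by
      change S.cover i (L (t, K (t, b))) = Isot.at t (F.1 * G.1) (S.cover i b)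
      rw [hL, hK, map_mul]
      rfl
  simp only [ContinuousMap.coe_mk] at e1 e2 e3
  have h := abs_displacement_sub_le L0 hL b (K (1, b)) 1
  rw [e1, e2, e3]
  convert h using 2
  ring

/-- Composing `ν̂` with a homomorphism induced by a linear functional gives a quasimorphism. -/
theorem isQuasimorphism_comp_nuHat [T2Space M] (χ : ((Fin m → ℝ) ⧸ S.periodGroup) →+ ℝ)
    (c : Fin m → ℝ) (hχ : ∀ v : Fin m → ℝ, χ (QuotientAddGroup.mk v) = ∑ i, c i * v i) :
    IsQuasimorphism fun f : DiffPairZero n S.union => χ (S.nuHat f) := by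
  refine ⟨∑ i, |c i|, ?_⟩
  rintro ⟨_, F, rfl⟩ ⟨_, G, rfl⟩
  have e : ∀ F : IsotPairZero n S.union,
      χ (S.nuHat ⟨endMap n S.union F, F, rfl⟩) = ∑ i, c i * S.nu F i := fun F => by
    rw [S.nuHat_endMap, hχ]
  have e3 : (⟨endMap n S.union F, F, rfl⟩ * ⟨endMap n S.union G, G, rfl⟩ :
      DiffPairZero n S.union) = ⟨endMap n S.union (F * G), F * G, rfl⟩ :=
    Subtype.ext (map_mul _ _ _).symm
  simp only [e3, e]
  rw [← Finset.sum_sub_distrib, ← Finset.sum_sub_distrib]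
  refine (Finset.abs_sum_le_sum_abs _ _).trans (Finset.sum_le_sum fun i _ => ?_)
  rw [← mul_sub, ← mul_sub, abs_mul]
  exact mul_le_of_le_one_right (abs_nonneg _) (S.abs_nu_mul_sub_le F G i)

/-- A subgroup of `ℝ^m` of rank less than `m` is contained in the kernel of a nonzero linear
functional. -/
theorem _root_.AddSubgroup.exists_dual_ne_zero_of_rank_lt {m : ℕ} (A : AddSubgroup (Fin m → ℝ))
    (hA : Module.rank ℤ A < (m : Cardinal)) :
    ∃ l : (Fin m → ℝ) →ₗ[ℝ] ℝ, l ≠ 0 ∧ ∀ a ∈ A, l a = 0 := by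
  -- A real basis of the span chosen inside `A` is also independent over `ℤ`, so the dimension of
  -- the span is at most the rank of `A`.
  obtain ⟨s, hsA, hspan, hli⟩ := exists_linearIndependent ℝ (A : Set (Fin m → ℝ))
  let V : Submodule ℝ (Fin m → ℝ) := Submodule.span ℝ (A : Set (Fin m → ℝ))
  have hV : V ≠ ⊤ := by
    intro hV
    have hliA : LinearIndependent ℤ fun x : s => (⟨x, hsA x.2⟩ : A) :=
      LinearIndependent.of_comp A.subtype.toIntLinearMap
        (hli.restrict_scalars fun a b h => by simpa using h)
    have h1 : Cardinal.mk s ≤ Module.rank ℤ A := hliA.cardinal_le_rank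
    have h2 : Module.rank ℝ V ≤ Cardinal.mk s := by
      change Module.rank ℝ (Submodule.span ℝ (A : Set (Fin m → ℝ))) ≤ _
      rw [← hspan]
      exact rank_span_le _
    rw [hV, rank_top, rank_fin_fun] at h2
    exact absurd hA (h2.trans h1).not_gt
  obtain ⟨x, hx⟩ : ∃ x, x ∉ V := by
    by_contra! h
    exact hV (eq_top_iff.2 fun x _ => h x)
  obtain ⟨l, hl, hlV⟩ := Submodule.exists_le_ker_of_notMem hx
  exact ⟨l, fun h => hl (by rw [h]; rfl), fun a ha => hlV (Submodule.subset_span ha)⟩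

end CircleFamily

/-! ### Compactly supported pushes in a vector space. -/

/-- A smooth perturbation of the identity with small Lipschitz constant is a diffeomorphism. -/
theorem LipschitzWith.exists_homeomorph_add_contDiff {V : Type*} [NormedAddCommGroup V]
    [NormedSpace ℝ V] [CompleteSpace V] [Nontrivial V] {h : V → V} {c : NNReal} (hc : c < 1)
    (hl : LipschitzWith c h) {k : WithTop ℕ∞} (hk : k ≠ 0) (hh : ContDiff ℝ k h) :
    ∃ T : V ≃ₜ V, (∀ x, T x = x + h x) ∧ ContDiff ℝ k T ∧ ContDiff ℝ k T.symm := by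
  have ha : ApproximatesLinearOn (fun x => x + h x)
      ((ContinuousLinearEquiv.refl ℝ V : V ≃L[ℝ] V) : V →L[ℝ] V) Set.univ c := by
    intro x _ y _
    have e : x + h x - (y + h y) - (ContinuousLinearEquiv.refl ℝ V : V →L[ℝ] V) (x - y)
        = h x - h y := by
      simp only [ContinuousLinearEquiv.coe_refl, ContinuousLinearMap.id_apply]; abel
    rw [e, ← dist_eq_norm, ← dist_eq_norm]
    exact hl.dist_le_mul x y
  have hcn : c < ‖(((ContinuousLinearEquiv.refl ℝ V).symm : V ≃L[ℝ] V) : V →L[ℝ] V)‖₊⁻¹ := by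
    have : ‖(((ContinuousLinearEquiv.refl ℝ V).symm : V ≃L[ℝ] V) : V →L[ℝ] V)‖₊ = 1 := by
      ext; exact ContinuousLinearMap.norm_id
    rwa [this, inv_one]
  let T : V ≃ₜ V := ha.toHomeomorph _ (Or.inr hcn)
  have hT : ∀ x, T x = x + h x := fun x => rfl
  have hTc : ContDiff ℝ k T := contDiff_id.add hh
  -- The derivative `1 - (-fderiv ℝ h x)` is then invertible by the Neumann series, which makes the
  -- inverse of `T` smooth.
  have hd : ∀ x, ‖-fderiv ℝ h x‖ < 1 := fun x => by
    rw [norm_neg]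
    exact (norm_fderiv_le_of_lipschitz ℝ hl).trans_lt (by exact_mod_cast hc)
  refine ⟨T, hT, hTc, T.contDiff_symm (f₀' := fun x =>
    ContinuousLinearEquiv.unitsEquiv ℝ V (Units.oneSub _ (hd x))) (fun x => ?_) hTc⟩
  have h1 : HasFDerivAt (fun x => x + h x) (ContinuousLinearMap.id ℝ V + fderiv ℝ h x) x :=
    (hasFDerivAt_id x).add ((hh.differentiable hk).differentiableAt.hasFDerivAt)
  refine HasFDerivAt.congr_fderiv h1 ?_
  ext v
  change v + fderiv ℝ h x v = v - -(fderiv ℝ h x v)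
  rw [sub_neg_eq_add]

/-- The point `p` of a finite dimensional space can be pushed in the direction `e` by smooth
families of diffeomorphisms supported near `p`. -/
theorem exists_local_push {E : Type*} [NormedAddCommGroup E] [NormedSpace ℝ E]
    [FiniteDimensional ℝ E] (p e : E) {r : ℝ} (hr : 0 < r) :
    ∃ (c : ℝ) (T Q : E × ℝ → E), 0 < c ∧ ContDiff ℝ ∞ T ∧ ContDiff ℝ ∞ Q ∧
      (∀ x s, T (Q (x, s), s) = x) ∧ (∀ x s, Q (T (x, s), s) = x) ∧
      (∀ x s, x ∉ Metric.closedBall p r → T (x, s) = x) ∧ (∀ x, T (x, 0) = x) ∧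
      (∀ x s, ∃ a : ℝ, T (x, s) = x + a • e) ∧
      ∀ s, |s| ≤ 1 → T (p, s) = p + (c * s) • e := by
  let ρ : ContDiffBump p := ⟨r / 2, r, half_pos hr, half_lt_self hr⟩
  let χ : ContDiffBump (0 : ℝ) := ⟨1, 2, one_pos, one_lt_two⟩
  -- The parameter is treated as an extra coordinate, so that one inversion on `E × ℝ` gives joint
  -- smoothness of `Q`. The cutoff `χ` in the parameter makes the perturbation compactly supported,
  -- hence Lipschitz.
  let g : E × ℝ → ℝ := fun z => z.2 * χ z.2 * ρ z.1
  have hg : ContDiff ℝ ∞ g :=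
    (contDiff_snd.mul (χ.contDiff.comp contDiff_snd)).mul (ρ.contDiff.comp contDiff_fst)
  let h : E × ℝ → E × ℝ := fun z => (g z • e, 0)
  have hh : ContDiff ℝ ∞ h := (hg.smul contDiff_const).prodMk contDiff_const
  have hsupp : HasCompactSupport h := by
    refine HasCompactSupport.of_support_subset_isCompact
      ((isCompact_closedBall p r).prod (isCompact_closedBall (0 : ℝ) 2)) fun z hz => ?_
    have hgz : g z ≠ 0 := fun h0 => hz (by simp only [h, h0, zero_smul]; rfl)
    have h1 : z.1 ∈ Function.support ρ := right_ne_zero_of_mul hgz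
    have h2 : z.2 ∈ Function.support χ := right_ne_zero_of_mul (left_ne_zero_of_mul hgz)
    rw [ContDiffBump.support_eq] at h1 h2
    exact ⟨Metric.ball_subset_closedBall h1, Metric.ball_subset_closedBall h2⟩
  obtain ⟨C, hC⟩ := hh.lipschitzWith_of_hasCompactSupport hsupp (by simp)
  -- Rescaling by `c` brings the Lipschitz constant below 1, also when `C = 0`.
  let c : NNReal := (2 * (C + 1))⁻¹
  have hc0 : 0 < c := by positivity
  have hcC : c * C < 1 := by
    rw [inv_mul_lt_iff₀ (by positivity), mul_one]
    calc C < C + 1 := lt_add_one C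
      _ ≤ 2 * (C + 1) := le_mul_of_one_le_left zero_le one_le_two
  have hl : LipschitzWith (c * C) fun z => (c : ℝ) • h z := by
    refine LipschitzWith.of_dist_le_mul fun x y => ?_
    rw [dist_smul₀, Real.norm_eq_abs, NNReal.abs_eq, NNReal.coe_mul, mul_assoc]
    exact mul_le_mul_of_nonneg_left (hC.dist_le_mul x y) c.2
  obtain ⟨Φ, hΦ, hΦ1, hΦ2⟩ := hl.exists_homeomorph_add_contDiff (k := ∞) hcC (by simp)
    (hh.const_smul _)
  have hT : ∀ x s, Φ (x, s) = (x + (c * g (x, s)) • e, s) := fun x s => by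
    rw [hΦ]
    simp only [h, Prod.smul_mk, smul_zero, Prod.mk_add_mk, add_zero, smul_smul]
  have hΦ' : ∀ x s, Φ (x, s) = ((Φ (x, s)).1, s) := fun x s => by rw [hT]
  have hQ' : ∀ x s, Φ.symm (x, s) = ((Φ.symm (x, s)).1, s) := fun x s => by
    refine Prod.ext rfl ?_
    have := hΦ' (Φ.symm (x, s)).1 (Φ.symm (x, s)).2
    rw [Prod.mk.eta, Φ.apply_symm_apply] at this
    exact (congrArg Prod.snd this).symm
  refine ⟨c, fun z => (Φ z).1, fun z => (Φ.symm z).1, by exact_mod_cast hc0, contDiff_fst.comp hΦ1,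
    contDiff_fst.comp hΦ2, fun x s => ?_, fun x s => ?_, fun x s hx => ?_, fun x => ?_,
    fun x s => ⟨_, congrArg Prod.fst (hT x s)⟩, fun s hs => ?_⟩
  · simp only [← hQ', Φ.apply_symm_apply]
  · simp only [← hΦ', Φ.symm_apply_apply]
  · have h0 : ρ x = 0 := by
      rw [← Function.notMem_support, ContDiffBump.support_eq]
      exact fun h => hx (Metric.ball_subset_closedBall h)
    simp only [hT, g, h0, mul_zero, zero_smul, add_zero]
  · simp only [hT, g, zero_mul, mul_zero, zero_smul, add_zero]
  · have h1 : χ s = 1 := χ.one_of_mem_closedBall (by rwa [mem_closedBall_zero_iff])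
    have h2 : ρ p = 1 := ρ.one_of_mem_closedBall (Metric.mem_closedBall_self (half_pos hr).le)
    simp only [hT, g, h1, h2, mul_one]

/-! ### Transplanting pushes from a chart to the manifold. -/

section ChartExtend

variable {n : ℕ} {M : Type*} [TopologicalSpace M]

open Classical in
/-- The extension by the identity of a family of maps defined in a chart. -/
noncomputable def chartExtend (φ : OpenPartialHomeomorph M (EuclideanSpace ℝ (Fin n)))
    (T : EuclideanSpace ℝ (Fin n) × ℝ → EuclideanSpace ℝ (Fin n)) (z : M × ℝ) : M :=
  if z.1 ∈ φ.source then φ.symm (T (φ z.1, z.2)) else z.1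

variable {φ : OpenPartialHomeomorph M (EuclideanSpace ℝ (Fin n))}
  {T Q : EuclideanSpace ℝ (Fin n) × ℝ → EuclideanSpace ℝ (Fin n)}
  {K : Set (EuclideanSpace ℝ (Fin n))}

theorem chartExtend_of_mem {y : M} (hy : y ∈ φ.source) (s : ℝ) :
    chartExtend φ T (y, s) = φ.symm (T (φ y, s)) := if_pos hy

theorem chartExtend_of_notMem (hT : ∀ x s, x ∉ K → T (x, s) = x) {y : M} (s : ℝ)
    (hy : y ∉ φ.symm '' K) : chartExtend φ T (y, s) = y := by
  by_cases h : y ∈ φ.source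
  · rw [chartExtend_of_mem h, hT _ _ fun hK => hy ⟨φ y, hK, φ.left_inv h⟩, φ.left_inv h]
  · exact if_neg h

/-- A value outside `K` would itself be fixed by `T`, so injectivity would make it equal to `x`. -/
theorem mem_of_eq_self_off (hT : ∀ x s, x ∉ K → T (x, s) = x)
    (hQT : ∀ x s, Q (T (x, s), s) = x) {x} (s : ℝ) (hx : x ∈ K) : T (x, s) ∈ K := by
  by_contra h
  have := congrArg (fun y => Q (y, s)) (hT _ s h)
  simp only [hQT] at this
  exact h (by rwa [this])

theorem mem_target_of_eq_self_off (hK : K ⊆ φ.target) (hT : ∀ x s, x ∉ K → T (x, s) = x)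
    (hQT : ∀ x s, Q (T (x, s), s) = x) {x} (s : ℝ) (hx : x ∈ φ.target) : T (x, s) ∈ φ.target := by
  by_cases h : x ∈ K
  · exact hK (mem_of_eq_self_off hT hQT s h)
  · rwa [hT x s h]

theorem chartExtend_leftInverse (hK : K ⊆ φ.target) (hT : ∀ x s, x ∉ K → T (x, s) = x)
    (hQT : ∀ x s, Q (T (x, s), s) = x) (y : M) (s : ℝ) :
    chartExtend φ Q (chartExtend φ T (y, s), s) = y := by
  by_cases h : y ∈ φ.source
  · have ht := mem_target_of_eq_self_off hK hT hQT s (φ.map_source h)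
    rw [chartExtend_of_mem h, chartExtend_of_mem (φ.map_target ht), φ.right_inv ht, hQT,
      φ.left_inv h]
  · have e : ∀ T, chartExtend φ T (y, s) = y := fun T => if_neg h
    rw [e, e]

variable [ChartedSpace (EuclideanSpace ℝ (Fin n)) M]

/-- The chart domain and the complement of the image of `K` cover `M`, and on the latter the map is
the projection. That complement is open because a compact set is closed in a Hausdorff space. -/
theorem contMDiff_chartExtend [T2Space M] [IsManifold (𝓡 n) ∞ M]
    (hφ : φ ∈ IsManifold.maximalAtlas (𝓡 n) ∞ M) (hKc : IsCompact K) (hK : K ⊆ φ.target)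
    (hT : ∀ x s, x ∉ K → T (x, s) = x) (hQT : ∀ x s, Q (T (x, s), s) = x)
    (hTs : ContDiff ℝ ∞ T) :
    ContMDiff ((𝓡 n).prod 𝓘(ℝ, ℝ)) (𝓡 n) ∞ (chartExtend φ T) := by
  rintro ⟨y, s⟩
  by_cases h : y ∈ φ.source
  · have ht := mem_target_of_eq_self_off hK hT hQT s (φ.map_source h)
    have h1 : ContMDiffAt ((𝓡 n).prod 𝓘(ℝ, ℝ)) (𝓡 n) ∞ (fun z : M × ℝ => φ z.1) (y, s) :=
      ((contMDiffOn_of_mem_maximalAtlas hφ).contMDiffAt (φ.open_source.mem_nhds h)).comp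
        (y, s) contMDiffAt_fst
    have h2 : ContMDiff ((𝓡 n).prod 𝓘(ℝ, ℝ)) (𝓡 n) ∞ T := by
      have := hTs.contMDiff
      rwa [modelWithCornersSelf_prod, ← chartedSpaceSelf_prod] at this
    have h3 : ContMDiffAt (𝓡 n) (𝓡 n) ∞ φ.symm (T (φ y, s)) :=
      (contMDiffOn_symm_of_mem_maximalAtlas hφ).contMDiffAt (φ.open_target.mem_nhds ht)
    have h4 : ContMDiffAt ((𝓡 n).prod 𝓘(ℝ, ℝ)) (𝓡 n) ∞
        (fun z : M × ℝ => φ.symm (T (φ z.1, z.2))) (y, s) :=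
      ContMDiffAt.comp (y, s) (f := fun z : M × ℝ => T (φ z.1, z.2)) h3
        (ContMDiffAt.comp (y, s) (f := fun z : M × ℝ => (φ z.1, z.2)) h2.contMDiffAt
          (h1.prodMk contMDiffAt_snd))
    refine h4.congr_of_eventuallyEq ?_
    filter_upwards [continuous_fst.continuousAt.preimage_mem_nhds (φ.open_source.mem_nhds h)]
      with z hz using chartExtend_of_mem hz z.2
  · have hc : IsClosed (φ.symm '' K) :=
      (hKc.image_of_continuousOn (φ.continuousOn_symm.mono hK)).isClosed
    have hy : y ∉ φ.symm '' K := by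
      rintro ⟨x, hx, rfl⟩
      exact h (φ.map_target (hK hx))
    refine contMDiffAt_fst.congr_of_eventuallyEq ?_
    filter_upwards [continuous_fst.continuousAt.preimage_mem_nhds (hc.isOpen_compl.mem_nhds hy)]
      with z hz using chartExtend_of_notMem hT z.2 hz

/-- A smooth family of diffeomorphisms supported in a chart gives isotopies. -/
theorem exists_isot_chartExtend [T2Space M] [IsManifold (𝓡 n) ∞ M]
    (hφ : φ ∈ IsManifold.maximalAtlas (𝓡 n) ∞ M) (hKc : IsCompact K) (hK : K ⊆ φ.target)
    (hT : ∀ x s, x ∉ K → T (x, s) = x) (hQ : ∀ x s, x ∉ K → Q (x, s) = x)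
    (hQT : ∀ x s, Q (T (x, s), s) = x) (hTQ : ∀ x s, T (Q (x, s), s) = x)
    (hTs : ContDiff ℝ ∞ T) (hQs : ContDiff ℝ ∞ Q) (a : ℝ) :
    ∃ F : Isot n M, ∀ (t : unitInterval) x, Isot.at t F x = chartExtend φ T (x, a * t) := by
  have key : ∀ R : M × ℝ → M, ContMDiff ((𝓡 n).prod 𝓘(ℝ, ℝ)) (𝓡 n) ∞ R →
      ContMDiff ((𝓡 n).prod (𝓡∂ 1)) ((𝓡 n).prod (𝓡∂ 1)) ∞
        (fun z : M × unitInterval => (R (z.1, a * z.2), z.2)) := fun R hR => by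
    have h1 : ContMDiff 𝓘(ℝ, ℝ) 𝓘(ℝ, ℝ) ∞ fun t : ℝ => a * t :=
      (contDiff_const.mul contDiff_id).contMDiff
    have h2 : ContMDiff ((𝓡 n).prod (𝓡∂ 1)) 𝓘(ℝ, ℝ) ∞
        (fun z : M × unitInterval => a * (z.2 : ℝ)) :=
      h1.comp (contMDiff_subtypeVal_Icc.comp contMDiff_snd)
    exact (hR.comp (contMDiff_fst.prodMk h2)).prodMk contMDiff_snd
  refine ⟨⟨⟨⟨fun z => (chartExtend φ T (z.1, a * z.2), z.2),
    fun z => (chartExtend φ Q (z.1, a * z.2), z.2),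
    fun z => Prod.ext (chartExtend_leftInverse hK hT hQT _ _) rfl,
    fun z => Prod.ext (chartExtend_leftInverse hK hQ hTQ _ _) rfl⟩,
    key _ (contMDiff_chartExtend hφ hKc hK hT hQT hTs),
    key _ (contMDiff_chartExtend hφ hKc hK hQ hTQ hQs)⟩, fun z => rfl⟩, fun t x => rfl⟩

end ChartExtend

/-! ### Realizing arbitrary rotation angles. -/

namespace CircleFamily

variable {n m : ℕ} {M : Type*} [TopologicalSpace M] [ChartedSpace (EuclideanSpace ℝ (Fin n)) M]
  (S : CircleFamily n m M)

/-- Some isotopy which fixes the circles other than `S_i` moves `x` to `y` in the universal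
covering of `S_i`. -/
def Reaches (i : Fin m) (x y : ℝ) : Prop :=
  ∃ F : IsotPairZero n S.union, (∀ j ≠ i, ∀ t z, Isot.at t F.1 (S.param j z) = S.param j z) ∧
    ∃ g : C(unitInterval, ℝ), g 0 = x ∧ g 1 = y ∧
      ∀ t, S.cover i (g t) = Isot.at t F.1 (S.cover i x)

variable {S} in
-- With `Reaches.symm` and `eventually_reaches`, this makes `Reaches` an equivalence relation with
-- open classes.
theorem Reaches.trans [T2Space M] {i : Fin m} {x y z : ℝ} (hxy : S.Reaches i x y)
    (hyz : S.Reaches i y z) : S.Reaches i x z := by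
  obtain ⟨F, hF, g, rfl, rfl, hg⟩ := hxy
  obtain ⟨G, hG, h, h0, rfl, hh⟩ := hyz
  obtain ⟨L, L0, hL⟩ := S.exists_lift_isot G i
  have mul_apply : ∀ t x, Isot.at t (G * F).1 x = Isot.at t G.1 (Isot.at t F.1 x) := fun t x =>
    congrArg (fun f : Diff n M => f x) (map_mul (Isot.at t) G.1 F.1)
  refine ⟨G * F, fun j hj t z => by rw [mul_apply, hF j hj, hG j hj],
    ⟨fun t => L (t, g t), by fun_prop⟩, L0 _, ?_, fun t => by
      rw [mul_apply, ← hg]; exact hL t _⟩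
  have e := S.lift_sub_eq i (⟨fun t => L (t, g 1), by fun_prop⟩ : C(unitInterval, ℝ)) h
    (fun t => (hL t _).trans (hh t).symm) 1 0
  simp only [ContinuousMap.coe_mk, L0, h0] at e
  change L (1, g 1) = h 1
  linarith

variable {S} in
theorem Reaches.symm [T2Space M] {i : Fin m} {x y : ℝ} (hxy : S.Reaches i x y) :
    S.Reaches i y x := by
  obtain ⟨F, hF, g, rfl, rfl, hg⟩ := hxy
  obtain ⟨L, L0, hL⟩ := S.exists_lift_isot F⁻¹ i
  have inv_apply : ∀ t x, Isot.at t (F⁻¹).1 (Isot.at t F.1 x) = x := fun t x =>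
    (Isot.at t F.1).symm_apply_apply x
  refine ⟨F⁻¹, fun j hj t z => ?_, ⟨fun t => L (t, g 1), by fun_prop⟩, L0 _, ?_,
    fun t => hL t _⟩
  · conv_lhs => rw [← hF j hj t z, inv_apply]
  -- Following `F` and then undoing it lifts a constant path, so the lift is constant.
  · have e := S.lift_sub_eq i (⟨fun t => L (t, g t), by fun_prop⟩ : C(unitInterval, ℝ))
      (ContinuousMap.const _ (g 0)) (fun t => (hL t (g t)).trans (by
        rw [hg, inv_apply, ContinuousMap.const_apply])) 1 0
    simp only [ContinuousMap.coe_mk, L0, ContinuousMap.const_apply] at e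
    change L (1, g 1) = g 0
    linarith

/-- Charts in which the circle `S_i` is a straight line near a given point. -/
theorem exists_straightening_charts (i : Fin m) (z₀ : Circle) :
    ∃ (F : Type) (_ : NormedAddCommGroup F) (_ : NormedSpace ℝ F)
      (e : (EuclideanSpace ℝ (Fin 1) × F) ≃L[ℝ] EuclideanSpace ℝ (Fin n))
      (ψ : OpenPartialHomeomorph Circle (EuclideanSpace ℝ (Fin 1)))
      (φ : OpenPartialHomeomorph M (EuclideanSpace ℝ (Fin n))),
      φ ∈ IsManifold.maximalAtlas (𝓡 n) ∞ M ∧ z₀ ∈ ψ.source ∧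
      ∀ z ∈ ψ.source, S.param i z ∈ φ.source ∧ φ (S.param i z) = e (ψ z, 0) := by
  have h := (S.isSmoothEmbedding i).isImmersion.isImmersionAt z₀
  refine ⟨h.complement, inferInstance, inferInstance, h.equiv, h.domChart, h.codChart,
    h.codChart_mem_maximalAtlas, h.mem_domChart_source, fun z hz =>
    ⟨h.source_subset_preimage_source hz, ?_⟩⟩
  have hz' : h.domChart z ∈ (h.domChart.extend (𝓡 1)).target := by
    simpa using h.domChart.map_source hz
  have h1 := h.writtenInCharts hz'
  simpa [h.domChart.left_inv hz] using h1

/-- Every point of `S_i` can be moved to all points in a neighbourhood of it. -/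
theorem eventually_reaches [T2Space M] [IsManifold (𝓡 n) ∞ M] (i : Fin m) (x : ℝ) :
    ∀ᶠ y in 𝓝 x, S.Reaches i x y := by
  let ex : ℝ → Circle := fun x => Circle.exp (2 * Real.pi * x)
  have hex : Continuous ex := Circle.exp.continuous.comp (continuous_const.mul continuous_id)
  obtain ⟨F, _, _, e, ψ, φ, hφ, hz₀, hψφ⟩ := S.exists_straightening_charts i (ex x)
  have hemb := (S.isSmoothEmbedding i).isEmbedding
  -- Inside `V` the circle has no strand other than the arc `ψ.source`; this is where embeddedness,
  -- not just immersion, enters.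
  obtain ⟨V, hV, hVψ⟩ := hemb.isInducing.isOpen_iff.1 ψ.open_source
  have hclosed : ∀ j, IsClosed (Set.range (S.param j)) := fun j =>
    (isCompact_range (S.isSmoothEmbedding j).isEmbedding.continuous).isClosed
  let N' : Set M := ⋃ j ∈ {j : Fin m | j ≠ i}, Set.range (S.param j)
  have hN' : IsClosed N' := Set.Finite.isClosed_biUnion (Set.toFinite _) fun j _ => hclosed j
  have hcN' : S.param i (ex x) ∉ N' := by
    intro h
    obtain ⟨j, hj, h⟩ := Set.mem_iUnion₂.1 h
    exact Set.disjoint_left.1 (S.disjoint j i hj) h ⟨_, rfl⟩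
  let p := φ (S.param i (ex x))
  have hps : S.param i (ex x) ∈ φ.source := (hψφ _ hz₀).1
  have hpe : p = e (ψ (ex x), 0) := (hψφ _ hz₀).2
  have hpt : p ∈ φ.target := φ.map_source hps
  -- A small ball around `p` avoids the other circles, meets `S_i` only in the straight arc, and has
  -- its coordinate along the arc in `ψ.target`.
  have hW : ∀ᶠ w in 𝓝 p, w ∈ φ.target ∧ φ.symm w ∈ V ∩ N'ᶜ ∧ (e.symm w).1 ∈ ψ.target := by
    refine Filter.Eventually.and (φ.open_target.mem_nhds hpt) (Filter.Eventually.and ?_ ?_)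
    · refine (φ.continuousAt_symm hpt).preimage_mem_nhds
        ((hV.inter hN'.isOpen_compl).mem_nhds ?_)
      rw [φ.left_inv hps]
      exact ⟨show ex x ∈ S.param i ⁻¹' V from hVψ ▸ hz₀, hcN'⟩
    · have hc : Continuous fun w => (e.symm w).1 := continuous_fst.comp e.symm.continuous
      refine hc.continuousAt.preimage_mem_nhds (ψ.open_target.mem_nhds ?_)
      rw [hpe, e.symm_apply_apply]
      exact ψ.map_source hz₀
  obtain ⟨r, hr, hK⟩ := Metric.nhds_basis_closedBall.mem_iff.1 hW
  obtain ⟨c, T, Q, hc, hTs, hQs, hTQ, hQT, hTK, hT0, hTe, hTp⟩ :=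
    exists_local_push p (e (EuclideanSpace.single 0 1, 0)) hr
  have hQK : ∀ x s, x ∉ Metric.closedBall p r → Q (x, s) = x := fun x s hx => by
    conv_lhs => rw [← hTK x s hx, hQT]
  have hQe : ∀ x s, ∃ a : ℝ, Q (x, s) = x + a • e (EuclideanSpace.single 0 1, 0) := fun x s => by
    obtain ⟨a, ha⟩ := hTe (Q (x, s)) s
    rw [hTQ] at ha
    exact ⟨-a, by rw [neg_smul]; nth_rewrite 2 [ha]; abel⟩
  have hKt : Metric.closedBall p r ⊆ φ.target := fun w hw => (hK hw).1
  have hother : ∀ R : EuclideanSpace ℝ (Fin n) × ℝ → EuclideanSpace ℝ (Fin n),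
      (∀ x s, x ∉ Metric.closedBall p r → R (x, s) = x) → ∀ j ≠ i, ∀ z s,
      chartExtend φ R (S.param j z, s) = S.param j z := by
    intro R hR j hj z s
    refine chartExtend_of_notMem hR s ?_
    rintro ⟨w, hw, hwz⟩
    refine (hK hw).2.1.2 ?_
    rw [hwz]
    exact Set.mem_iUnion₂.2 ⟨j, hj, z, rfl⟩
  have hself : ∀ R : EuclideanSpace ℝ (Fin n) × ℝ → EuclideanSpace ℝ (Fin n),
      (∀ x s, x ∉ Metric.closedBall p r → R (x, s) = x) →
      (∀ x s, x ∈ Metric.closedBall p r → R (x, s) ∈ Metric.closedBall p r) →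
      (∀ x s, ∃ a : ℝ, R (x, s) = x + a • e (EuclideanSpace.single 0 1, 0)) → ∀ z s,
      chartExtend φ R (S.param i z, s) ∈ Set.range (S.param i) := by
    intro R hR hRK hRe z s
    by_cases h : S.param i z ∈ φ.symm '' Metric.closedBall p r
    · obtain ⟨w, hw, hwz⟩ := h
      have hz : z ∈ ψ.source := by
        rw [← hVψ, Set.mem_preimage, ← hwz]
        exact (hK hw).2.1.1
      have hw' : φ (S.param i z) = w := by rw [← hwz, φ.right_inv (hK hw).1]
      obtain ⟨a, ha⟩ := hRe w s
      have hRw := hRK w s hw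
      -- The push is along the line, so the image stays on it; being still in the ball, it has its
      -- coordinate in `ψ.target` and thus lies on the circle.
      have hRw' : R (w, s) = e (ψ z + a • EuclideanSpace.single 0 1, 0) := by
        rw [ha, ← hw', (hψφ z hz).2, ← map_smul, ← map_add]
        congr 1
        simp
      have ht := (hK hRw).2.2
      rw [hRw', e.symm_apply_apply] at ht
      refine ⟨ψ.symm (ψ z + a • EuclideanSpace.single 0 1), ?_⟩
      have h2 := hψφ _ (ψ.map_target ht)
      rw [chartExtend_of_mem (hψφ z hz).1, hw', hRw', ← φ.left_inv h2.1, h2.2, ψ.right_inv ht]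
    · rw [chartExtend_of_notMem hR s h]
      exact ⟨z, rfl⟩
  have hunion : ∀ R : EuclideanSpace ℝ (Fin n) × ℝ → EuclideanSpace ℝ (Fin n),
      (∀ x s, x ∉ Metric.closedBall p r → R (x, s) = x) →
      (∀ x s, x ∈ Metric.closedBall p r → R (x, s) ∈ Metric.closedBall p r) →
      (∀ x s, ∃ a : ℝ, R (x, s) = x + a • e (EuclideanSpace.single 0 1, 0)) → ∀ y ∈ S.union, ∀ s,
      chartExtend φ R (y, s) ∈ S.union := by
    intro R hR hRK hRe y hy s
    obtain ⟨j, z, rfl⟩ := Set.mem_iUnion.1 hy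
    by_cases hj : j = i
    · subst hj
      exact Set.mem_iUnion.2 ⟨j, hself R hR hRK hRe z s⟩
    · rw [hother R hR j hj]
      exact hy
  have hTm : ∀ x s, x ∈ Metric.closedBall p r → T (x, s) ∈ Metric.closedBall p r :=
    fun x s hx => mem_of_eq_self_off hTK hQT s hx
  have hQm : ∀ x s, x ∈ Metric.closedBall p r → Q (x, s) ∈ Metric.closedBall p r :=
    fun x s hx => mem_of_eq_self_off hQK hTQ s hx
  have hisot : ∀ a : ℝ, ∃ F : IsotPairZero n S.union,
      ∀ (t : unitInterval) y, Isot.at t F.1 y = chartExtend φ T (y, a * t) := by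
    intro a
    obtain ⟨F, hF⟩ := exists_isot_chartExtend hφ (isCompact_closedBall p r) hKt hTK hQK hQT hTQ
      hTs hQs a
    refine ⟨⟨F, fun t => ?_, Diffeomorph.ext fun y => ?_⟩, hF⟩
    · refine Set.Subset.antisymm ?_ fun y hy => ?_
      · rintro _ ⟨y, hy, rfl⟩
        rw [hF]
        exact hunion T hTK hTm hTe y hy _
      · refine ⟨chartExtend φ Q (y, a * t), hunion Q hQK hQm hQe y hy _, ?_⟩
        rw [hF, chartExtend_leftInverse hKt hQK hTQ]
    · rw [hF]
      change chartExtend φ T (y, a * (0 : ℝ)) = y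
      rw [mul_zero]
      by_cases hy : y ∈ φ.source
      · rw [chartExtend_of_mem hy, hT0, φ.left_inv hy]
      · exact if_neg hy
  have hcont : Continuous fun s : ℝ => chartExtend φ T (S.cover i x, s) :=
    (contMDiff_chartExtend hφ (isCompact_closedBall p r) hKt hTK hQT hTs).continuous.comp
      (continuous_const.prodMk continuous_id)
  obtain ⟨L, L0, hL⟩ := S.exists_lift i _ hcont (fun s => hself T hTK hTm hTe _ s) 0 x (by
    change S.param i (ex x) = chartExtend φ T (S.param i (ex x), 0)
    rw [chartExtend_of_mem hps, hT0, φ.left_inv hps])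
  -- The parameter at which the push carries `x` to `y`: the difference of chart coordinates divided
  -- by the speed `c`.
  let d : ℝ → ℝ := fun y => (ψ (ex y) - ψ (ex x)) 0 / c
  have hd : ContinuousAt d x := by
    have h1 : ContinuousAt (fun y => ψ (ex y)) x :=
      ContinuousAt.comp (f := ex) (ψ.continuousAt hz₀) hex.continuousAt
    have h2 : Continuous fun v : EuclideanSpace ℝ (Fin 1) => v 0 := by fun_prop
    exact (h2.continuousAt.comp (h1.sub continuousAt_const)).div_const c
  have hdx : d x = 0 := by simp [d]
  have hLd : ContinuousAt (fun y => L (d y)) x := L.continuous.continuousAt.comp hd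
  -- The bound `|d y| < 1` keeps the push in its linear range; having `y` and `L (d y)` within 1/2
  -- of `x` excludes a nonzero integer difference.
  filter_upwards [hex.continuousAt.preimage_mem_nhds (ψ.open_source.mem_nhds hz₀),
    hd.eventually (Metric.ball_mem_nhds (d x) one_pos),
    hLd.eventually (Metric.ball_mem_nhds (L (d x)) one_half_pos),
    Metric.ball_mem_nhds x one_half_pos] with y hy1 hy2 hy3 hy4
  rw [Metric.mem_ball] at hy4
  rw [Real.dist_eq] at hy2 hy3 hy4
  rw [hdx, sub_zero] at hy2
  rw [hdx, L0] at hy3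
  have hcov : S.cover i (L (d y)) = S.cover i y := by
    rw [hL]
    change chartExtend φ T (S.param i (ex x), d y) = S.param i (ex y)
    have hcd : (c * d y) • EuclideanSpace.single (0 : Fin 1) (1 : ℝ) = ψ (ex y) - ψ (ex x) := by
      ext k
      fin_cases k
      simp [d, mul_div_cancel₀ _ hc.ne']
    rw [chartExtend_of_mem hps, hTp _ hy2.le, hpe, ← map_smul, ← map_add, Prod.smul_mk, hcd,
      Prod.mk_add_mk, add_sub_cancel, smul_zero, add_zero, ← (hψφ _ hy1).2,
      φ.left_inv (hψφ _ hy1).1]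
  have hLy : L (d y) = y := by
    obtain ⟨k, hk⟩ := (S.cover_eq_iff i _ _).1 hcov
    have h1 : |(k : ℝ)| < 1 := by
      have e1 : (k : ℝ) = (L (d y) - x) - (y - x) := by rw [hk]; ring
      rw [e1]
      linarith [abs_sub (L (d y) - x) (y - x)]
    have h2 : k = 0 := Int.abs_lt_one_iff.1 (by exact_mod_cast h1)
    rw [hk, h2, Int.cast_zero, add_zero]
  obtain ⟨G, hG⟩ := hisot (d y)
  refine ⟨G, fun j hj t z => by rw [hG, hother T hTK j hj],
    ⟨fun t => L (d y * t), by fun_prop⟩, ?_, ?_, fun t => ?_⟩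
  · change L (d y * (0 : ℝ)) = x
    rw [mul_zero, L0]
  · change L (d y * (1 : ℝ)) = y
    rw [mul_one, hLy]
  · rw [hG]
    exact hL _

/-- The class of `x` and its complement are open, and `ℝ` is connected. -/
theorem reaches [T2Space M] [IsManifold (𝓡 n) ∞ M] (i : Fin m) (x y : ℝ) :
    S.Reaches i x y := by
  have hcl : IsClopen {y | S.Reaches i x y} := by
    refine ⟨isOpen_compl_iff.1 (isOpen_iff_mem_nhds.2 fun y hy => ?_),
      isOpen_iff_mem_nhds.2 fun y hy => ?_⟩
    · filter_upwards [S.eventually_reaches i y] with z hz hxz using hy (hxz.trans hz.symm)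
    · filter_upwards [S.eventually_reaches i y] with z hz using hy.trans hz
  have h : y ∈ {y | S.Reaches i x y} := by
    rw [hcl.eq_univ ⟨x, (S.eventually_reaches i x).self_of_nhds⟩]
    exact Set.mem_univ y
  exact h

theorem exists_nu_eq_single [T2Space M] [IsManifold (𝓡 n) ∞ M] (i : Fin m) (r : ℝ) :
    ∃ F : IsotPairZero n S.union, S.nu F = Pi.single i r := by
  obtain ⟨b, hb⟩ := S.cover_surj i (S.base i)
  obtain ⟨F, hF, g, h0, h1, hg⟩ := S.reaches i b (b + r)
  refine ⟨F, funext fun j => ?_⟩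
  by_cases hj : j = i
  · subst hj
    rw [S.nu_eq F j hb h0 hg, h1, Pi.single_eq_same, add_sub_cancel_left]
  · obtain ⟨b', hb'⟩ := S.cover_surj j (S.base j)
    rw [S.nu_eq F j hb' (g := ContinuousMap.const _ b') rfl fun t => by
      rw [hb', hF j hj]; exact hb', Pi.single_eq_of_ne hj, ContinuousMap.const_apply, sub_self]

end CircleFamily

/-! ### The functional `χ` and the conclusion. -/

theorem proposition1p3 (n m : ℕ) (hn : 2 ≤ n)
    (M : Type*) [TopologicalSpace M] [T2Space M] [CompactSpace M]
    [ChartedSpace (EuclideanSpace ℝ (Fin n)) M] [IsManifold (𝓡 n) ∞ M]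
    (S : CircleFamily n m M) (hA : Module.rank ℤ S.periodGroup < (m : Cardinal)) :
    (∃ χ : ((Fin m → ℝ) ⧸ S.periodGroup) →+ ℝ,
      Function.Surjective χ ∧
      Function.Surjective (fun f : DiffPairZero n S.union => χ (S.nuHat f)) ∧
      IsQuasimorphism (fun f : DiffPairZero n S.union => χ (S.nuHat f))) ∧
    ¬ IsBoundedGroup (DiffPairZero n S.union) ∧
    ¬ IsUniformlyPerfect (DiffPairZero n S.union) := by
  obtain ⟨l, hl0, hlA⟩ := S.periodGroup.exists_dual_ne_zero_of_rank_lt hA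
  let χ : ((Fin m → ℝ) ⧸ S.periodGroup) →+ ℝ :=
    QuotientAddGroup.lift S.periodGroup l.toAddMonoidHom hlA
  have hχ : ∀ v : Fin m → ℝ, χ (QuotientAddGroup.mk v) = l v := fun v => rfl
  have hl : ∀ v : Fin m → ℝ, l v = ∑ i, l (Pi.single i 1) * v i := fun v => by
    rw [LinearMap.pi_apply_eq_sum_univ l v]
    refine Finset.sum_congr rfl fun i _ => ?_
    rw [smul_eq_mul, mul_comm]
    congr 2
    ext j
    simp [Pi.single_apply, eq_comm]
  obtain ⟨i, hi⟩ : ∃ i, l (Pi.single i 1) ≠ 0 := by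
    by_contra! h
    exact hl0 (LinearMap.ext fun v => by simp [hl v, h])
  have hsurj : Function.Surjective fun f : DiffPairZero n S.union => χ (S.nuHat f) := fun r => by
    -- Rotating a single circle whose coefficient in `l` is nonzero already gives every real value.
    obtain ⟨F, hF⟩ := S.exists_nu_eq_single i (r / l (Pi.single i 1))
    refine ⟨⟨endMap n S.union F, F, rfl⟩, ?_⟩
    change χ (S.nuHat _) = r
    have e : (Pi.single i (r / l (Pi.single i 1)) : Fin m → ℝ) =
        (r / l (Pi.single i 1)) • Pi.single i 1 := by
      rw [← Pi.single_smul, smul_eq_mul, mul_one]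
    rw [S.nuHat_endMap, hχ, hF, e, map_smul, smul_eq_mul, div_mul_cancel₀ _ hi]
  have hquasi : IsQuasimorphism fun f : DiffPairZero n S.union => χ (S.nuHat f) :=
    S.isQuasimorphism_comp_nuHat χ (fun i => l (Pi.single i 1)) hl
  have hunb : ∀ C, ∃ f : DiffPairZero n S.union, C < |χ (S.nuHat f)| := fun C => by
    obtain ⟨f, hf⟩ := hsurj (|C| + 1)
    refine ⟨f, ?_⟩
    rw [show χ (S.nuHat f) = |C| + 1 from hf]
    linarith [le_abs_self C, le_abs_self (|C| + 1)]
  exact ⟨⟨χ, hsurj.of_comp, hsurj, hquasi⟩, hquasi.not_isBoundedGroup hunb,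
    hquasi.not_isUniformlyPerfect hunb⟩
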